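/- Let $(P;\le)$ be the random partial order, i.e. the (up to isomorphism unique) countable partial order that embeds every finite partial order and is homogeneous (every isomorphism between finite suborders extends to an automorphism). Write $x\perp y$ if $x,y$ are incomparable. For disjoint $X,Y\subseteq P$ write $X\le Y$ if $x\le y$ for some $x\in X$, $y\in Y$, and $X<Y$ if $x<y$ for all $x\in X$, $y\in Y$. A \emph{random filter} is an upward closed set $F\subseteq P$ such that $(P;\le,F)$ is the Fraïssé limit of the class of all finite partial orders with a distinguished upward closed subset, i.e. $(P;\le,F)$ embeds every such finite structure and is homogeneous. For a random filter $F$ let $<_F$ be the strict order on $P$ which agrees with $<$ on $F$ and on $P\setminus F$, and for which, for $x\in F$ and $y\in P\setminus F$, one has $x<_F y$ iff $x\perp y$, and never $y<_F x$. Let ${\circlearrowright}_F$ be a permutation of $P$ which is an isomorphism from $(P;<_F)$ onto $(P;<)$. Let $\mathcal T$ be the smallest group of permutations of $P$ which contains ${\circlearrowright}_F$ and all automorphisms of $(P;\le)$ and which is closed in $\mathrm{Sym}_P$ in the topology of pointwise convergence ($P$ discrete). Let $X,Y,Z$ be pairwise disjoint, possibly empty sets with union $P$, such that $X$ is an ideal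 (downward closed), $Z$ is a filter (upward closed), $X<Z$, and $X\le Y$ (if both are nonempty) and $Y\le Z$ (if both are nonempty). A \emph{rotation} with respect to $X,Y,Z$ is a permutation $f$ of $P$ such that $u<v$ implies $f(u)<f(v)$ and $u\perp v$ implies $f(u)\perp f(v)$ whenever $u,v$ lie in the same class, and such that for all $x\in X$, $y\in Y$, $z\in Z$ (each condition being imposed for all values of the two variables that occur in it): - $f(z)<f(x)$; - $f(y)<f(x)$ iff $x\perp y$, and $f(y)\perp f(x)$ iff $x<y$; - $f(z)<f(y)$ iff $y\perp z$, and $f(z)\perp f(y)$ iff $y<z$. A rotation on $P$ is a rotation with respect to some such $X,Y,Z$. Then, for every choice of the random filter $F$ and of ${\circlearrowright}_F$, the group $\mathcal T$ consists precisely of the rotations on $P$. In particular, the composition of two rotations on $P$ is again a rotation on $P$. -/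

import Mathlib

namespace RandomPoset

/-- The random partial order: countable, embedding every finite partial order, and homogeneous
(every isomorphism between finite suborders extends to an automorphism). These three properties
determine it up to isomorphism. -/
structure IsRandomPartialOrder (P : Type*) [PartialOrder P] : Prop where
  countable : Countable P
  universal : ∀ (A : Type) [Finite A] [PartialOrder A], Nonempty (A ↪o P)
  homogeneous : ∀ (S : Set P) (φ : P → P), S.Finite →
    (∀ x ∈ S, ∀ y ∈ S, φ x ≤ φ y ↔ x ≤ y) →
    ∃ α : P ≃o P, ∀ x ∈ S, α x = φ x

variable {P : Type*} [PartialOrder P]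

/-- Incomparability, `x ⊥ y`. -/
abbrev Incomp (x y : P) : Prop := IncompRel (· ≤ ·) x y

/-- A random filter of the random partial order `P`: an upward closed set `F` such that `(P; ≤, F)`
is the Fraïssé limit of the class of all finite partial orders with a distinguished upward closed
subset, that is, it embeds all of these structures and is homogeneous. -/
structure IsRandomFilter (F : Set P) : Prop where
  isUpperSet : IsUpperSet F
  universal : ∀ (A : Type) [Finite A] [PartialOrder A] (U : Set A), IsUpperSet U →
    ∃ e : A ↪o P, ∀ a, e a ∈ F ↔ a ∈ U
  homogeneous : ∀ (S : Set P) (φ : P → P), S.Finite →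
    (∀ x ∈ S, ∀ y ∈ S, φ x ≤ φ y ↔ x ≤ y) → (∀ x ∈ S, φ x ∈ F ↔ x ∈ F) →
    ∃ α : P ≃o P, (∀ x, α x ∈ F ↔ x ∈ F) ∧ ∀ x ∈ S, α x = φ x

/-- The strict order obtained from that of `P` by turning around `F`: it is unchanged within `F` and
within the complement of `F`, and an element `x` of `F` is put below an element `y` of the complement
exactly when `x` and `y` were incomparable. All other pairs become incomparable. -/
def TurnLT (F : Set P) (x y : P) : Prop :=
  ((x ∈ F ↔ y ∈ F) ∧ x < y) ∨ (x ∈ F ∧ y ∉ F ∧ Incomp x y)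

/-- `t` is a turn around `F`: an isomorphism from `P` with the turned order onto `P`. -/
def IsTurn (F : Set P) (t : Equiv.Perm P) : Prop :=
  ∀ x y, t x < t y ↔ TurnLT F x y

/-- `G` is closed in the full symmetric group with the topology of pointwise convergence (`P` being
discrete): it contains each permutation that agrees on every finite set with some element of `G`. -/
def IsClosedGroup {α : Type*} (G : Subgroup (Equiv.Perm α)) : Prop :=
  ∀ f : Equiv.Perm α, (∀ S : Finset α, ∃ g ∈ G, ∀ x ∈ S, g x = f x) → f ∈ G

/-- The group generated by the permutation `t`: the smallest closed group of permutations of `P`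
containing all automorphisms of `P` and `t`. -/
def turnGroup (t : Equiv.Perm P) : Subgroup (Equiv.Perm P) :=
  sInf {G | IsClosedGroup G ∧ (∀ α : P ≃o P, α.toEquiv ∈ G) ∧ t ∈ G}

/-- `X ≤ Y`: some element of `X` is below some element of `Y`. -/
def SetLE (X Y : Set P) : Prop := ∃ x ∈ X, ∃ y ∈ Y, x ≤ y

/-- `X < Y`: all elements of `X` are strictly below all elements of `Y`. -/
def SetLT (X Y : Set P) : Prop := ∀ x ∈ X, ∀ y ∈ Y, x < y

/-- `f` behaves like the identity on `X`. -/
def BehavesLikeId (f : P → P) (X : Set P) : Prop :=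
  ∀ x ∈ X, ∀ x' ∈ X, (x < x' → f x < f x') ∧ (Incomp x x' → Incomp (f x) (f x'))

/-- `X`, `Y`, `Z` partition `P` as required for a rotation. Classes may be empty; the conditions
`X ≤ Y` and `Y ≤ Z` are imposed between nonempty classes only. -/
structure IsRotationPartition (X Y Z : Set P) : Prop where
  disjoint_XY : Disjoint X Y
  disjoint_XZ : Disjoint X Z
  disjoint_YZ : Disjoint Y Z
  cover : X ∪ Y ∪ Z = Set.univ
  ideal : IsLowerSet X
  filter : IsUpperSet Z
  le_XY : X.Nonempty → Y.Nonempty → SetLE X Y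
  le_YZ : Y.Nonempty → Z.Nonempty → SetLE Y Z
  lt_XZ : SetLT X Z

/-- `f` is a rotation with respect to `X`, `Y`, `Z`. -/
structure IsRotationWrt (X Y Z : Set P) (f : Equiv.Perm P) : Prop where
  partition : IsRotationPartition X Y Z
  id_X : BehavesLikeId f X
  id_Y : BehavesLikeId f Y
  id_Z : BehavesLikeId f Z
  between_XZ : ∀ x ∈ X, ∀ z ∈ Z, f z < f x
  between_XY : ∀ x ∈ X, ∀ y ∈ Y,
    (f y < f x ↔ Incomp x y) ∧ (Incomp (f y) (f x) ↔ x < y)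
  between_YZ : ∀ y ∈ Y, ∀ z ∈ Z,
    (f z < f y ↔ Incomp y z) ∧ (Incomp (f z) (f y) ↔ y < z)

/-- `f` is a rotation on `P`. -/
def IsRotation (f : Equiv.Perm P) : Prop := ∃ X Y Z : Set P, IsRotationWrt X Y Z f

end RandomPoset

namespace RandomPoset

/-! ### Finite extensions in the random partial order. -/

section Extension

universe u

variable {P : Type u} [PartialOrder P]

/-! Rotations are the permutations induced by sections of a cover. `CoverLT` orders `P × ℤ`
invariantly under the shift of the second coordinate, and `IsLift f l` says that `f` carries the
order of the section `u ↦ (u, l u)` to that of `P`. Such an `f` extends to an automorphism of the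
cover commuting with the shift (`IsLift.coverLT_iff`), so levels add under composition and these
permutations form a group. By `IsLift.bounds` levels spread over at most three consecutive integers;
normalized to 1, 0, -1, their fibres are the classes X, Y, Z. Turns are the case of levels 0 and -1.
Finitely many possible values give closedness by a compactness argument. Conversely, on a finite set
each rotation is two partial turns followed by an automorphism. -/

/-- A finite type carries the same orders as some type in the lowest universe. -/
lemma exists_small_copy (A : Type u) [Finite A] [PartialOrder A] :
    ∃ (B : Type) (_ : PartialOrder B), Finite B ∧ Nonempty (A ≃o B) := by
  obtain ⟨n, ⟨e⟩⟩ := Finite.exists_equiv_fin A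
  let i : PartialOrder (Fin n) := PartialOrder.lift e.symm e.symm.injective
  refine ⟨Fin n, i, inferInstance, ⟨⟨e, ?_⟩⟩⟩
  intro a b
  change e.symm (e a) ≤ e.symm (e b) ↔ a ≤ b
  simp

lemma IsRandomPartialOrder.exists_embedding (hP : IsRandomPartialOrder P)
    (A : Type u) [Finite A] [PartialOrder A] : Nonempty (A ↪o P) := by
  obtain ⟨B, _, _, ⟨e⟩⟩ := exists_small_copy A
  obtain ⟨i⟩ := hP.universal B
  exact ⟨e.toOrderEmbedding.trans i⟩

lemma IsRandomFilter.exists_embedding {F : Set P} (hF : IsRandomFilter F)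
    (A : Type u) [Finite A] [PartialOrder A] (U : Set A) (hU : IsUpperSet U) :
    ∃ e : A ↪o P, ∀ a, e a ∈ F ↔ a ∈ U := by
  obtain ⟨B, _, _, ⟨e⟩⟩ := exists_small_copy A
  obtain ⟨i, hi⟩ := hF.universal B (e.symm ⁻¹' U) (hU.preimage e.symm.monotone)
  refine ⟨e.toOrderEmbedding.trans i, fun a => ?_⟩
  simpa using hi (e a)

lemma IsRandomPartialOrder.exists_orderIso_eq (hP : IsRandomPartialOrder P) {S : Set P}
    (hS : S.Finite) (e : S ↪o P) : ∃ α : P ≃o P, ∀ s : S, α s = e s := by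
  classical
  obtain ⟨α, hα⟩ := hP.homogeneous S (fun x => if h : x ∈ S then e ⟨x, h⟩ else x) hS
    (by intro x hx y hy; simp [hx, hy])
  exact ⟨α, fun s => by simp [hα s s.2]⟩

/-- Finite extensions of finite suborders are realized. -/
lemma IsRandomPartialOrder.exists_extension (hP : IsRandomPartialOrder P) {S : Set P}
    (hS : S.Finite) (A : Type u) [Finite A] [PartialOrder A] (i : S ↪o A) :
    ∃ e : A ↪o P, ∀ s, e (i s) = s := by
  obtain ⟨e⟩ := hP.exists_embedding A
  obtain ⟨α, hα⟩ := hP.exists_orderIso_eq hS (i.trans e)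
  refine ⟨e.trans α.symm.toOrderEmbedding, fun s => ?_⟩
  have := hα s
  simp only [RelEmbedding.coe_trans, Function.comp_apply] at this
  simp [← this]

lemma IsRandomPartialOrder.exists_le_le (hP : IsRandomPartialOrder P) (u v : P) :
    ∃ w, w ≤ u ∧ w ≤ v := by
  have hS : ({u, v} : Set P).Finite := Set.toFinite _
  have := hS.to_subtype
  obtain ⟨e, he⟩ := hP.exists_extension hS (WithBot ({u, v} : Set P)) WithBot.coeOrderHom
  refine ⟨e ⊥, ?_, ?_⟩
  · exact (e.le_iff_le.2 bot_le).trans_eq (he ⟨u, by simp⟩)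
  · exact (e.le_iff_le.2 bot_le).trans_eq (he ⟨v, by simp⟩)

lemma IsRandomPartialOrder.exists_ge_ge (hP : IsRandomPartialOrder P) (u v : P) :
    ∃ w, u ≤ w ∧ v ≤ w := by
  have hS : ({u, v} : Set P).Finite := Set.toFinite _
  have := hS.to_subtype
  obtain ⟨e, he⟩ := hP.exists_extension hS (WithTop ({u, v} : Set P)) WithTop.coeOrderHom
  refine ⟨e ⊤, ?_, ?_⟩
  · exact (he ⟨u, by simp⟩).symm.trans_le (e.le_iff_le.2 le_top)
  · exact (he ⟨v, by simp⟩).symm.trans_le (e.le_iff_le.2 le_top)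

lemma IsRandomPartialOrder.exists_incomp (hP : IsRandomPartialOrder P) (u v : P) :
    ∃ w, Incomp w u ∧ Incomp w v := by
  have hS : ({u, v} : Set P).Finite := Set.toFinite _
  have := hS.to_subtype
  let i : ({u, v} : Set P) ↪o ({u, v} : Set P) ⊕ PUnit.{u + 1} :=
    ⟨⟨Sum.inl, Sum.inl_injective⟩, Sum.inl_le_inl_iff⟩
  obtain ⟨e, he⟩ := hP.exists_extension hS (({u, v} : Set P) ⊕ PUnit.{u + 1}) i
  have key : ∀ s : ({u, v} : Set P), Incomp (e (Sum.inr PUnit.unit)) s := by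
    intro s
    rw [← he s]
    exact ⟨fun h => Sum.not_inr_le_inl (e.le_iff_le.1 h),
      fun h => Sum.not_inl_le_inr (e.le_iff_le.1 h)⟩
  exact ⟨_, key ⟨u, by simp⟩, key ⟨v, by simp⟩⟩

end Extension

/-! ### Level functions, and the closed group of rotations. -/

section Lift

variable {P : Type*} [PartialOrder P]

/-- The order of the cover `P × ℤ` of `P`: `(u, i)` lies below `(v, i + k)`. -/
def CoverLT (u v : P) (k : ℤ) : Prop :=
  (k = 0 ∧ u < v) ∨ (k = 1 ∧ ¬ v < u) ∨ 2 ≤ k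

/-- `f` is induced by the choice of levels `l` in the cover. -/
def IsLift (f : Equiv.Perm P) (l : P → ℤ) : Prop :=
  ∀ u v, f u < f v ↔ CoverLT u v (l v - l u)

lemma incomp_iff {x y : P} : Incomp x y ↔ x ≠ y ∧ ¬ x < y ∧ ¬ y < x := by
  unfold Incomp IncompRel
  constructor
  · rintro ⟨h1, h2⟩
    exact ⟨fun h => h1 h.le, fun h => h1 h.le, fun h => h2 h.le⟩
  · rintro ⟨h0, h1, h2⟩
    exact ⟨fun h => h1 (lt_of_le_of_ne h h0), fun h => h2 (lt_of_le_of_ne h h0.symm)⟩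

/-- An element `w` with `f w` incomparable to both `f u` and `f v` has level within 1 of each. Level
`l u + 1` forces `w < u`, level `l u - 1` forces `u < w`, and likewise for `v`; transitivity through
`w` does the rest. -/
lemma IsLift.bounds (hP : IsRandomPartialOrder P) {f : Equiv.Perm P} {l : P → ℤ}
    (h : IsLift f l) (u v : P) :
    (u < v → l v ≤ l u) ∧ l v ≤ l u + 2 ∧ (l v = l u + 2 → v < u) := by
  obtain ⟨w', h1, h2⟩ := hP.exists_incomp (f u) (f v)
  obtain ⟨w, rfl⟩ := f.surjective w'
  rw [incomp_iff] at h1 h2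
  obtain ⟨-, a1, a2⟩ := h1
  obtain ⟨-, b1, b2⟩ := h2
  rw [h] at a1 a2 b1 b2
  unfold CoverLT at a1 a2 b1 b2
  have t1 : u < v → v < w → u < w := lt_trans
  have t2 : w < u → u < v → w < v := lt_trans
  have t3 : v < w → w < u → v < u := lt_trans
  refine ⟨fun huv => ?_, ?_, fun huv => ?_⟩ <;> grind

/-- In other words, `(f u, i) ↦ (u, i + l u)` is an automorphism of the cover. -/
lemma IsLift.coverLT_iff (hP : IsRandomPartialOrder P) {f : Equiv.Perm P} {l : P → ℤ}
    (h : IsLift f l) (u v : P) (k : ℤ) :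
    CoverLT (f u) (f v) k ↔ CoverLT u v (k + (l v - l u)) := by
  have h1 := h u v
  have h2 := h v u
  have b1 := h.bounds hP u v
  have b2 := h.bounds hP v u
  have t : u < v → ¬ v < u := lt_asymm
  by_cases huv : u = v
  · subst huv
    simp [CoverLT]
  have hne : f u ≠ f v := fun h => huv (f.injective h)
  unfold CoverLT at *
  rw [h1, h2]
  grind

lemma IsLift.mul (hP : IsRandomPartialOrder P) {f g : Equiv.Perm P} {l m : P → ℤ}
    (hf : IsLift f l) (hg : IsLift g m) : IsLift (f * g) (fun u => l (g u) + m u) := by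
  intro u v
  rw [Equiv.Perm.mul_apply, Equiv.Perm.mul_apply, hf, hg.coverLT_iff hP]
  ring_nf

lemma IsLift.inv (hP : IsRandomPartialOrder P) {f : Equiv.Perm P} {l : P → ℤ}
    (hf : IsLift f l) : IsLift f⁻¹ (fun u => - l (f⁻¹ u)) := by
  intro u v
  have := hf.coverLT_iff hP (f⁻¹ u) (f⁻¹ v) (- l (f⁻¹ v) - - l (f⁻¹ u))
  rw [← Equiv.Perm.mul_apply, ← Equiv.Perm.mul_apply, mul_inv_cancel, Equiv.Perm.one_apply,
    Equiv.Perm.one_apply] at this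
  rw [this]
  ring_nf
  simp [CoverLT]

lemma IsLift.sub_const {f : Equiv.Perm P} {l : P → ℤ} (hf : IsLift f l) (c : ℤ) :
    IsLift f (fun u => l u - c) := by
  intro u v
  rw [hf]
  ring_nf

lemma isLift_orderIso (α : P ≃o P) : IsLift α.toEquiv (fun _ => 0) := by
  intro u v
  simp [CoverLT]

open Classical in
lemma IsTurn.isLift {F : Set P} {t : Equiv.Perm P} (hF : IsUpperSet F) (ht : IsTurn F t) :
    IsLift t (fun u => if u ∈ F then -1 else 0) := by
  intro u v
  rw [ht]
  have h1 : u < v → u ∈ F → v ∈ F := fun h => hF h.le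
  have h2 : u = v → u ∈ F → v ∈ F := by rintro rfl; exact id
  unfold TurnLT CoverLT
  rw [incomp_iff]
  by_cases hu : u ∈ F <;> by_cases hv : v ∈ F <;> grind

open Classical in
lemma IsRotationWrt.isLift {X Y Z : Set P} {f : Equiv.Perm P} (h : IsRotationWrt X Y Z f) :
    IsLift f (fun u => if u ∈ X then 1 else if u ∈ Z then -1 else 0) := by
  have hXZ : ∀ u ∈ X, u ∉ Z := fun u h1 h2 => Set.disjoint_left.1 h.partition.disjoint_XZ h1 h2
  have cover : ∀ u, u ∉ X → u ∉ Z → u ∈ Y := by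
    intro u h1 h2
    have : u ∈ X ∪ Y ∪ Z := h.partition.cover ▸ Set.mem_univ u
    simp only [Set.mem_union] at this
    tauto
  have same : ∀ C : Set P, BehavesLikeId f C → ∀ u ∈ C, ∀ v ∈ C, (f u < f v ↔ u < v) := by
    intro C hC u hu v hv
    refine ⟨fun hlt => ?_, (hC u hu v hv).1⟩
    by_contra hn
    by_cases hvu : v < u
    · exact lt_asymm hlt ((hC v hv u hu).1 hvu)
    · have hne : u ≠ v := by rintro rfl; exact lt_irrefl _ hlt
      exact ((hC u hu v hv).2 (incomp_iff.2 ⟨hne, hn, hvu⟩)).1 hlt.le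
  have hYX : ∀ x ∈ X, ∀ y, y ∉ X → y ∉ Z → (f y < f x ↔ ¬ x < y) ∧ ¬ f x < f y := by
    intro x hx y hyX hyZ
    have hy := cover y hyX hyZ
    obtain ⟨h1, h2⟩ := h.between_XY x hx y hy
    have h3 : ¬ y < x := fun hlt => hyX (h.partition.ideal hlt.le hx)
    have h4 : x ≠ y := by rintro rfl; exact hyX hx
    rw [incomp_iff] at h1 h2
    have h5 : f y < f x → ¬ f x < f y := lt_asymm
    tauto
  have hZY : ∀ z ∈ Z, ∀ y, y ∉ X → y ∉ Z → (f z < f y ↔ ¬ y < z) ∧ ¬ f y < f z := by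
    intro z hz y hyX hyZ
    have hy := cover y hyX hyZ
    obtain ⟨h1, h2⟩ := h.between_YZ y hy z hz
    have h3 : ¬ z < y := fun hlt => hyZ (h.partition.filter hlt.le hz)
    have h4 : y ≠ z := by rintro rfl; exact hyZ hz
    rw [incomp_iff] at h1 h2
    have h5 : f z < f y → ¬ f y < f z := lt_asymm
    tauto
  have hX := same X h.id_X
  have hZ := same Z h.id_Z
  have hY := same Y h.id_Y
  intro u v
  by_cases u1 : u ∈ X
  · by_cases v1 : v ∈ X
    · simp [u1, v1, CoverLT, hX u u1 v v1]
    · by_cases v2 : v ∈ Z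
      · have := lt_asymm (h.between_XZ u u1 v v2)
        simp [u1, v1, v2, CoverLT, this]
      · simp [u1, v1, v2, CoverLT, hYX u u1 v v1 v2]
  · by_cases u2 : u ∈ Z
    · by_cases v1 : v ∈ X
      · simp [u1, u2, v1, CoverLT, h.between_XZ v v1 u u2]
      · by_cases v2 : v ∈ Z
        · simp [u1, u2, v1, v2, CoverLT, hZ u u2 v v2]
        · simp [u1, u2, v1, v2, CoverLT, hZY u u2 v v1 v2]
    · by_cases v1 : v ∈ X
      · simp [u1, u2, v1, CoverLT, hYX v v1 u u1 u2]
      · by_cases v2 : v ∈ Z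
        · simp [u1, u2, v1, v2, CoverLT, hZY v v2 u u1 u2]
        · simp [u1, u2, v1, v2, CoverLT, hY u (cover u u1 u2) v (cover v v1 v2)]

/-- The levels of a lift can be chosen in `{-1, 0, 1}`. -/
lemma IsLift.exists_normalized (hP : IsRandomPartialOrder P) {f : Equiv.Perm P} {l : P → ℤ}
    (hf : IsLift f l) : ∃ m, IsLift f m ∧ ∀ u, m u = -1 ∨ m u = 0 ∨ m u = 1 := by
  have key : ∃ c, ∀ u, l u - c = -1 ∨ l u - c = 0 ∨ l u - c = 1 := by
    rcases isEmpty_or_nonempty P with hE | ⟨⟨a⟩⟩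
    · exact ⟨0, fun u => hE.elim u⟩
    have hb : ∀ u v, l v ≤ l u + 2 := fun u v => (hf.bounds hP u v).2.1
    by_cases h2 : ∃ u v, l v = l u + 2
    · obtain ⟨u, v, huv⟩ := h2
      -- If the spread 2 is attained, the middle level becomes 0; otherwise any attained level can
      -- serve.
      exact ⟨l u + 1, fun w => by have := hb u w; have := hb w v; omega⟩
    · push Not at h2
      exact ⟨l a, fun w => by
        have := hb a w; have := hb w a; have := h2 a w; have := h2 w a; omega⟩
  obtain ⟨c, hc⟩ := key
  exact ⟨fun u => l u - c, hf.sub_const c, hc⟩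

lemma IsLift.isRotation (hP : IsRandomPartialOrder P) {f : Equiv.Perm P} {l : P → ℤ}
    (hf : IsLift f l) : IsRotation f := by
  obtain ⟨m, hm, hval⟩ := hf.exists_normalized hP
  have hb := hm.bounds hP
  have same : ∀ i, BehavesLikeId f {u | m u = i} := by
    intro i u hu v hv
    have h1 := hm u v
    have h2 := hm v u
    have : u ≠ v → f u ≠ f v := fun h => f.injective.ne h
    rw [Set.mem_ofPred_eq] at hu hv
    rw [incomp_iff, incomp_iff]
    simp only [hu, hv, CoverLT, sub_self] at h1 h2
    grind
  have adj : ∀ i u v, m u = i + 1 → m v = i →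
      (f v < f u ↔ Incomp u v) ∧ (Incomp (f v) (f u) ↔ u < v) := by
    intro i u v hu hv
    have h1 := hm u v
    have h2 := hm v u
    have h3 := (hb v u).1
    have h4 : u ≠ v := by rintro rfl; omega
    have h5 : f v ≠ f u := f.injective.ne h4.symm
    have h6 : u < v → ¬ v < u := lt_asymm
    rw [incomp_iff, incomp_iff]
    simp only [hu, hv, CoverLT] at h1 h2
    grind
  have low : ∀ u v, u ≤ v → m v ≤ m u := by
    intro u v huv
    rcases huv.lt_or_eq with h | rfl
    · exact (hb u v).1 h
    · exact le_rfl
  refine ⟨{u | m u = 1}, {u | m u = 0}, {u | m u = -1}, ⟨?_, ?_, ?_, ?_, ?_, ?_, ?_, ?_, ?_⟩,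
    same _, same _, same _, ?_, fun x hx y hy => adj 0 x y hx hy,
    fun y hy z hz => adj (-1) y z (by simpa using hy) hz⟩
  · rw [Set.disjoint_left]; intro a h1 h2; simp only [Set.mem_ofPred_eq] at h1 h2; omega
  · rw [Set.disjoint_left]; intro a h1 h2; simp only [Set.mem_ofPred_eq] at h1 h2; omega
  · rw [Set.disjoint_left]; intro a h1 h2; simp only [Set.mem_ofPred_eq] at h1 h2; omega
  · ext a; have := hval a; simp only [Set.mem_union, Set.mem_ofPred_eq, Set.mem_univ]; tauto
  · intro a b hba ha
    have := low b a hba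
    have := hval b
    simp only [Set.mem_ofPred_eq] at *
    omega
  · intro a b hab ha
    have := low a b hab
    have := hval b
    simp only [Set.mem_ofPred_eq] at *
    omega
  · rintro ⟨x, hx⟩ ⟨y, hy⟩
    obtain ⟨w, h1, h2⟩ := hP.exists_le_le x y
    -- Levels weakly decrease upwards, so `w ≤ x` already has the top level 1.
    refine ⟨w, ?_, y, hy, h2⟩
    have := low w x h1
    have := hval w
    simp only [Set.mem_ofPred_eq] at *
    omega
  · rintro ⟨y, hy⟩ ⟨z, hz⟩
    obtain ⟨w, h1, h2⟩ := hP.exists_ge_ge y z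
    refine ⟨y, hy, w, ?_, h1⟩
    have := low z w h2
    have := hval w
    simp only [Set.mem_ofPred_eq] at *
    omega
  · intro x hx z hz
    simp only [Set.mem_ofPred_eq] at hx hz
    exact (hb z x).2.2 (by omega)
  · intro x hx z hz
    simp only [Set.mem_ofPred_eq] at hx hz
    rw [hm]
    exact Or.inr (Or.inr (by omega))

lemma isRotation_iff_exists_isLift (hP : IsRandomPartialOrder P) {f : Equiv.Perm P} :
    IsRotation f ↔ ∃ l, IsLift f l :=
  ⟨fun ⟨_, _, _, h⟩ => ⟨_, h.isLift⟩, fun ⟨_, h⟩ => h.isRotation hP⟩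

/-- The group of all rotations. -/
def rotationGroup (hP : IsRandomPartialOrder P) : Subgroup (Equiv.Perm P) where
  carrier := {f | ∃ l, IsLift f l}
  mul_mem' := fun ⟨_, hf⟩ ⟨_, hg⟩ => ⟨_, hf.mul hP hg⟩
  one_mem' := ⟨_, isLift_orderIso (OrderIso.refl P)⟩
  inv_mem' := fun ⟨_, hf⟩ => ⟨_, hf.inv hP⟩

lemma isClosedGroup_rotationGroup (hP : IsRandomPartialOrder P) :
    IsClosedGroup (rotationGroup hP) := by
  classical
  intro f hf
  have hex : ∀ S : Finset P, ∃ m : P → ℤ, (∀ u, m u = -1 ∨ m u = 0 ∨ m u = 1) ∧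
      ∀ u ∈ S, ∀ v ∈ S, (f u < f v ↔ CoverLT u v (m v - m u)) := by
    intro S
    obtain ⟨g, ⟨l, hl⟩, hg⟩ := hf S
    obtain ⟨m, hm, hval⟩ := hl.exists_normalized hP
    exact ⟨m, hval, fun u hu v hv => by rw [← hg u hu, ← hg v hv, hm]⟩
  choose m hval hm using hex
  -- The levels depend on `S`. As they take only three values, they converge pointwise along an
  -- ultrafilter containing all sets `{S | u ∈ S}`.
  let U : Ultrafilter (Finset P) := Ultrafilter.of Filter.atTop
  have hU : ∀ u : P, ∀ᶠ S in (U : Filter (Finset P)), u ∈ S := fun u =>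
    Ultrafilter.of_le Filter.atTop ((Filter.eventually_ge_atTop {u}).mono
      fun S hS => hS (Finset.mem_singleton_self u))
  have hlim : ∀ u : P, ∃ i : ℤ, ∀ᶠ S in (U : Filter (Finset P)), m S u = i := by
    intro u
    have : ∀ᶠ S in (U : Filter (Finset P)), m S u = -1 ∨ m S u = 0 ∨ m S u = 1 :=
      Filter.Eventually.of_forall fun S => hval S u
    rw [Ultrafilter.eventually_or, Ultrafilter.eventually_or] at this
    rcases this with h | h | h <;> exact ⟨_, h⟩
  choose l hl using hlim
  refine ⟨l, fun u v => ?_⟩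
  obtain ⟨S, hu, hv, h1, h2⟩ := ((hU u).and ((hU v).and ((hl u).and (hl v)))).exists
  rw [hm S u hu v hv, h1, h2]

end Lift

/-! ### Rotations as limits of products of turns and automorphisms. -/

section Turn

variable {P : Type*} [PartialOrder P]

/-- Finite partial turns are realized in each group containing a turn and the automorphisms. -/
lemma IsTurn.exists_turn_on (hP : IsRandomPartialOrder P) {F : Set P} {t : Equiv.Perm P}
    (hF : IsRandomFilter F) (ht : IsTurn F t) {G : Subgroup (Equiv.Perm P)}
    (hG : ∀ α : P ≃o P, α.toEquiv ∈ G) (htG : t ∈ G) {S : Set P} (hS : S.Finite) (U : Set P)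
    (hU : ∀ u ∈ S, ∀ v ∈ S, u ≤ v → u ∈ U → v ∈ U) :
    ∃ g ∈ G, ∀ u ∈ S, ∀ v ∈ S, (g u < g v ↔ TurnLT U u v) := by
  have := hS.to_subtype
  obtain ⟨e, he⟩ := hF.exists_embedding S (Subtype.val ⁻¹' U)
    (fun u v huv hu => hU u u.2 v v.2 huv hu)
  obtain ⟨α, hα⟩ := hP.exists_orderIso_eq hS e
  refine ⟨t * α.toEquiv, G.mul_mem htG (hG α), fun u hu v hv => ?_⟩
  have h1 : ∀ w ∈ S, (α w ∈ F ↔ w ∈ U) := fun w hw => by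
    rw [hα ⟨w, hw⟩, he]; rfl
  change t (α u) < t (α v) ↔ _
  rw [ht]
  simp only [TurnLT, h1 u hu, h1 v hv, incomp_iff, α.lt_iff_lt, α.injective.ne_iff]

lemma IsRotation.mem_of_isClosedGroup (hP : IsRandomPartialOrder P) {F : Set P}
    {t : Equiv.Perm P} (hF : IsRandomFilter F) (ht : IsTurn F t) {G : Subgroup (Equiv.Perm P)}
    (hG : ∀ α : P ≃o P, α.toEquiv ∈ G) (htG : t ∈ G) (hcl : IsClosedGroup G)
    {f : Equiv.Perm P} (hf : IsRotation f) : f ∈ G := by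
  obtain ⟨l, hl⟩ := (isRotation_iff_exists_isLift hP).1 hf
  obtain ⟨m, hm, hval⟩ := hl.exists_normalized hP
  have hb := hm.bounds hP
  have low : ∀ u v, u ≤ v → m v ≤ m u := by
    intro u v huv
    rcases huv.lt_or_eq with h | rfl
    · exact (hb u v).1 h
    · exact le_rfl
  refine hcl f fun S => ?_
  -- Turning around `m ≤ 0` and then around the image of `m = -1` gives total levels 0, -1, -2, that
  -- is `m - 1`, which induce the same order as `m`.
  obtain ⟨g, hgG, hg⟩ := ht.exists_turn_on hP hF hG htG S.finite_toSet {u | m u ≤ 0}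
    (fun u _ v _ huv hu => (low u v huv).trans hu)
  have hgU : ∀ a ∈ g '' (S : Set P), ∀ b ∈ g '' (S : Set P), a ≤ b →
      a ∈ g '' {u | m u = -1} → b ∈ g '' {u | m u = -1} := by
    rintro _ ⟨u, hu, rfl⟩ _ ⟨v, hv, rfl⟩ huv
    simp only [g.injective.mem_set_image, Set.mem_ofPred_eq]
    intro h
    rcases huv.lt_or_eq with hlt | heq
    · rw [hg u hu v hv, TurnLT, incomp_iff] at hlt
      have := hval v
      have := low u v
      have := (hb u v).2.2
      simp only [Set.mem_ofPred_eq] at hlt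
      have : u < v → u ≤ v := le_of_lt
      grind
    · rw [← g.injective heq, h]
  obtain ⟨k, hkG, hk⟩ := ht.exists_turn_on hP hF hG htG (S.finite_toSet.image g)
    (g '' {u | m u = -1}) hgU
  have hkg : ∀ u ∈ S, ∀ v ∈ S, (k (g u) < k (g v) ↔ f u < f v) := by
    intro u hu v hv
    rw [hk _ ⟨u, hu, rfl⟩ _ ⟨v, hv, rfl⟩, hm]
    have h1 := hg u hu v hv
    have h2 := hg v hv u hu
    have b1 := hb u v
    have b2 := hb v u
    by_cases huv : u = v
    · subst huv; simp [TurnLT, CoverLT, incomp_iff]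
    have t1 : u < v → ¬ v < u := lt_asymm
    simp only [TurnLT, CoverLT, incomp_iff, g.injective.mem_set_image, Set.mem_ofPred_eq,
      g.injective.ne_iff] at h1 h2 ⊢
    clear hg hk hgU hb low
    rcases hval u with hu' | hu' | hu' <;> rcases hval v with hv' | hv' | hv' <;>
      simp [hu', hv'] at b1 b2 h1 h2 ⊢ <;> grind
  let a : Equiv.Perm P := k * g
  -- `k * g` and `f` induce the same order on `S`, so homogeneity supplies the correcting
  -- automorphism.
  obtain ⟨α, hα⟩ := hP.homogeneous (a '' S) (f ∘ a.symm) (S.finite_toSet.image a) (by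
    rintro _ ⟨u, hu, rfl⟩ _ ⟨v, hv, rfl⟩
    simp only [Function.comp_apply, Equiv.symm_apply_apply, le_iff_lt_or_eq,
      f.injective.eq_iff, a.injective.eq_iff]
    exact or_congr (hkg u hu v hv).symm Iff.rfl)
  refine ⟨α.toEquiv * a, G.mul_mem (hG α) (G.mul_mem hkG hgG), fun u hu => ?_⟩
  have := hα (a u) ⟨u, hu, rfl⟩
  rw [Function.comp_apply, Equiv.symm_apply_apply] at this
  exact this

end Turn

end RandomPoset

theorem mainTheorem5 {P : Type*} [PartialOrder P] (hP : RandomPoset.IsRandomPartialOrder P) :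
    (∀ (F : Set P) (t : Equiv.Perm P), RandomPoset.IsRandomFilter F → RandomPoset.IsTurn F t →
      ∀ f : Equiv.Perm P, f ∈ RandomPoset.turnGroup t ↔ RandomPoset.IsRotation f) ∧
    (∀ f g : Equiv.Perm P, RandomPoset.IsRotation f → RandomPoset.IsRotation g →
      RandomPoset.IsRotation (f * g)) := by
  refine ⟨fun F t hF ht f => ⟨fun hf => ?_, fun hf => ?_⟩, fun f g hf hg => ?_⟩
  · rw [RandomPoset.isRotation_iff_exists_isLift hP]
    exact Subgroup.mem_sInf.1 hf (RandomPoset.rotationGroup hP)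
      ⟨RandomPoset.isClosedGroup_rotationGroup hP, fun α => ⟨_, RandomPoset.isLift_orderIso α⟩,
        ⟨_, ht.isLift hF.isUpperSet⟩⟩
  · exact Subgroup.mem_sInf.2 fun G hG => hf.mem_of_isClosedGroup hP hF ht hG.2.1 hG.2.2 hG.1
  · rw [RandomPoset.isRotation_iff_exists_isLift hP] at hf hg ⊢
    obtain ⟨l, hl⟩ := hf
    obtain ⟨m, hm⟩ := hg
    exact ⟨_, hl.mul hP hm⟩
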